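/- Theorem 1 (Dimension shifts). For $d\ge 1$ let $|\cdot|$ be the Euclidean norm on $\mathbb{R}^d$, and for $z\in\mathbb{C}^d$ put $\|z\|:=\sup\{|\sum_{n=1}^d z_nt_n| : t\in\mathbb{R}^d,\ |t|\le 1\}$. An entire function $F:\mathbb{C}^d\to\mathbb{C}$, not identically zero, has exponential type at most $\delta$ if $\limsup_{\|z\|\to\infty}\|z\|^{-1}\log|F(z)|\le\delta$; it is real entire if it is real-valued on $\mathbb{R}^d$. A function $f:\mathbb{R}^d\to\mathbb{R}$ is eventually non-negative if $f(x)\ge 0$ for all sufficiently large $|x|$, and then $r(f):=\inf\{r>0 : f(x)\ge 0 \text{ for all } |x|\ge r\}$. Let $\mu$ be an even, locally finite, non-negative Borel measure on $\mathbb{R}$. Let $\mu^d$ be its radial lift to $\mathbb{R}^d$: on $\mathbb{R}^d\setminus\{0\}$ it is given in polar coordinates $x=r\omega$, $r>0$, $\omega\in\mathbb{S}^{d-1}$, by $d\mu^d(x)=d\sigma_{d-1}(\omega)\,d\mu(r)$, where $\sigma_{d-1}$ is the surface measure of the unit sphere $\mathbb{S}^{d-1}$, and $\mu^d(\{0\})=\tfrac12\sigma_{d-1}(\mathbb{S}^{d-1})\,\mu(\{0\})$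 (so $\mu^1=\mu$). For $\delta\ge 0$ let $$\mathbb{E}(\mu;\delta;d):=\inf_F\, r(F|_{\mathbb{R}^d})\in[0,\infty],$$ where the infimum (equal to $+\infty$ if there is no such $F$) is taken over all real entire functions $F:\mathbb{C}^d\to\mathbb{C}$, not identically zero, of exponential type at most $\delta$, such that $F\in L^1(\mathbb{R}^d,\mu^d)$, $\int_{\mathbb{R}^d}F\,d\mu^d\le 0$, and $F|_{\mathbb{R}^d}$ is eventually non-negative. Then, for every such $\mu$, every $\delta\ge 0$ and every integer $d\ge 1$, $$\mathbb{E}(\mu;\delta;d)=\mathbb{E}(\mu;\delta;1).$$ -/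

import Mathlib

open MeasureTheory Filter
open scoped ENNReal

noncomputable section

namespace SignUncertainty

/-- The inclusion `ℝ^d ⊆ ℂ^d`. -/
def toComplex {d : ℕ} (x : EuclideanSpace ℝ (Fin d)) : EuclideanSpace ℂ (Fin d) :=
  WithLp.toLp 2 fun i => (x i : ℂ)

/-- The norm `sup {|∑ₙ zₙ tₙ| : t ∈ ℝ^d, |t| ≤ 1}` on `ℂ^d`. -/
def supNorm {d : ℕ} (z : EuclideanSpace ℂ (Fin d)) : ℝ :=
  sSup ((fun t : EuclideanSpace ℝ (Fin d) => ‖∑ n, z n * (t n : ℂ)‖) '' {t | ‖t‖ ≤ 1})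

/-- The exponential type `limsup_{‖z‖ → ∞} ‖z‖⁻¹ log |F z|`, an extended real number
(with `log 0 = -∞`), with respect to the norm `supNorm`. -/
def expType {d : ℕ} (F : EuclideanSpace ℂ (Fin d) → ℂ) : EReal :=
  limsup (fun z => ENNReal.log ‖F z‖ₑ / (supNorm z : EReal)) (comap supNorm atTop)

/-- The restriction to `ℝ^d` of a function on `ℂ^d` that is real-valued on `ℝ^d`. -/
def realRestrict {d : ℕ} (F : EuclideanSpace ℂ (Fin d) → ℂ) (x : EuclideanSpace ℝ (Fin d)) : ℝ :=
  (F (toComplex x)).re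

/-- A function on `ℝ^d` is eventually non-negative if it is non-negative for all large `|x|`. -/
def EventuallyNonneg {d : ℕ} (f : EuclideanSpace ℝ (Fin d) → ℝ) : Prop :=
  ∃ r : ℝ, ∀ x, r ≤ ‖x‖ → 0 ≤ f x

/-- The radius of the last sign change, `inf {r > 0 : f x ≥ 0 for |x| ≥ r}`. -/
def lastSignChange {d : ℕ} (f : EuclideanSpace ℝ (Fin d) → ℝ) : ℝ≥0∞ :=
  sInf (ENNReal.ofReal '' {r : ℝ | 0 < r ∧ ∀ x, r ≤ ‖x‖ → 0 ≤ f x})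

/-- The standard surface measure on the unit sphere of `ℝ^d`. -/
def surfaceMeasure (d : ℕ) : Measure (Metric.sphere (0 : EuclideanSpace ℝ (Fin d)) 1) :=
  (volume : Measure (EuclideanSpace ℝ (Fin d))).toSphere

/-- The radial lift of an even measure `μ` on `ℝ` to `ℝ^d`. Away from the origin it is
`dσ(ω) dμ(r)` in polar coordinates `x = r ω`, `r > 0`. An atom of `μ` at `0`, which belongs in equal
parts to the two half-lines, is lifted to an atom at the origin of mass `σ(S^{d-1}) / 2 * μ {0}`.
For `d = 1` this is `μ` itself. -/
def radialLift (μ : Measure ℝ) (d : ℕ) : Measure (EuclideanSpace ℝ (Fin d)) :=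
  Measure.map (fun p : ℝ × Metric.sphere (0 : EuclideanSpace ℝ (Fin d)) 1 =>
      p.1 • (p.2 : EuclideanSpace ℝ (Fin d)))
    ((μ.restrict (Set.Ioi 0)).prod (surfaceMeasure d))
  + (surfaceMeasure d Set.univ / 2 * μ {0}) • Measure.dirac 0

/-- The nonzero members of the class of admissible functions on `ℂ^d`. -/
structure Admissible (μ : Measure ℝ) (δ : ℝ) (d : ℕ) (F : EuclideanSpace ℂ (Fin d) → ℂ) :
    Prop where
  ne_zero : F ≠ 0
  entire : Differentiable ℂ F
  real : ∀ x : EuclideanSpace ℝ (Fin d), (F (toComplex x)).im = 0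
  expType_le : expType F ≤ (δ : EReal)
  integrable : Integrable (realRestrict F) (radialLift μ d)
  integral_nonpos : ∫ x, realRestrict F x ∂(radialLift μ d) ≤ 0
  eventuallyNonneg : EventuallyNonneg (realRestrict F)

/-- The sign-uncertainty constant: the infimum in `[0, ∞]` of the radius of the last sign change
over all nonzero admissible functions (`∞` if there are none). -/
def signConstant (μ : Measure ℝ) (δ : ℝ) (d : ℕ) : ℝ≥0∞ :=
  sInf ((fun F => lastSignChange (realRestrict F)) '' {F | Admissible μ δ d F})

end SignUncertainty

end

namespace SignUncertainty

/-! Averaging over spheres carries admissible functions from any dimension to any other. The mean `∫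
F(wω) dσ(ω)` is even and entire in `w`, hence equals `k(w²)` with `k` entire, and `G(z) = k(∑ zₙ²)`
is entire on `ℂ^d'`, with values at real `x` equal to the mean of `F` over the sphere of radius
`|x|`.

Non-negativity outside a ball survives averaging. The type does not grow because `|∑ zₙ²| ≤ ‖z‖²`
(`norm_sum_sq_le_supNorm_sq`). In polar coordinates the integral of `G` is a non-negative multiple
of that of `F`. Finally `G ≠ 0`: a vanishing mean would force `F`, non-negative far out, to vanish
there and so everywhere. As `d` and `d'` are arbitrary, both inequalities follow. -/

lemma norm_sum_le_supNorm {d : ℕ} (z : EuclideanSpace ℂ (Fin d)) {t : EuclideanSpace ℝ (Fin d)}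
    (ht : ‖t‖ ≤ 1) : ‖∑ n, z n * (t n : ℂ)‖ ≤ supNorm z := by
  refine le_csSup ⟨∑ n, ‖z n‖, ?_⟩ ⟨t, ht, rfl⟩
  rintro _ ⟨s, hs, rfl⟩
  refine (norm_sum_le _ _).trans (Finset.sum_le_sum fun n _ => ?_)
  rw [norm_mul, Complex.norm_real]
  exact mul_le_of_le_one_right (norm_nonneg _) ((PiLp.norm_apply_le s n).trans hs)

lemma supNorm_nonneg {d : ℕ} (z : EuclideanSpace ℂ (Fin d)) : 0 ≤ supNorm z :=
  (norm_nonneg _).trans (norm_sum_le_supNorm z (t := 0) (by simp))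

lemma supNorm_smul_toComplex {d : ℕ} (w : ℂ) {x : EuclideanSpace ℝ (Fin d)} (hx : ‖x‖ = 1) :
    supNorm (w • toComplex x) = ‖w‖ := by
  have key (t : EuclideanSpace ℝ (Fin d)) :
      ‖∑ n, (w • toComplex x) n * (t n : ℂ)‖ = ‖w‖ * |inner ℝ t x| := by
    have : ∑ n, (w • toComplex x) n * (t n : ℂ) = w * ((inner ℝ t x : ℝ) : ℂ) := by
      simp [PiLp.inner_apply, toComplex, Finset.mul_sum, mul_assoc]
    rw [this, norm_mul, Complex.norm_real, Real.norm_eq_abs]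
  refine le_antisymm ?_ ?_
  · refine csSup_le ⟨_, 0, by simp, rfl⟩ ?_
    rintro _ ⟨t, ht, rfl⟩
    simp only [Set.mem_ofPred_eq] at ht
    dsimp only
    rw [key]
    refine mul_le_of_le_one_right (norm_nonneg _) ((abs_real_inner_le_norm t x).trans ?_)
    rwa [hx, mul_one]
  · refine le_trans ?_ (norm_sum_le_supNorm _ hx.le)
    rw [key, real_inner_self_eq_norm_sq, hx]
    simp

/-- A unimodular `u` makes `u² ∑ zₙ²` equal to its modulus. Its real part is `|Re(uz)|² -
|Im(uz)|²`, so it is at most `|x|²` with `x = Re(uz)`, and testing `supNorm z` against `x/|x|`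
yields at least `|x|`. -/
lemma norm_sum_sq_le_supNorm_sq {d : ℕ} (z : EuclideanSpace ℂ (Fin d)) :
    ‖∑ n, z n ^ 2‖ ≤ supNorm z ^ 2 := by
  set S := ∑ n, z n ^ 2 with hS
  set u : ℂ := Complex.exp (((-(S.arg / 2) : ℝ) : ℂ) * Complex.I) with hu
  have hu1 : ‖u‖ = 1 := Complex.norm_exp_ofReal_mul_I _
  have huS : u ^ 2 * S = ‖S‖ := by
    conv_lhs => rw [← Complex.norm_mul_exp_arg_mul_I S]
    rw [hu, ← Complex.exp_nat_mul, mul_left_comm, ← Complex.exp_add]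
    push_cast
    rw [show 2 * (-((S.arg : ℂ) / 2) * Complex.I) + S.arg * Complex.I = 0 by ring]
    simp
  set x : EuclideanSpace ℝ (Fin d) := WithLp.toLp 2 fun n => (u * z n).re with hx
  have hSx : ‖S‖ ≤ ‖x‖ ^ 2 := by
    have h1 : ‖S‖ = ∑ n, ((u * z n) ^ 2).re := by
      have := congrArg Complex.re huS
      rw [Complex.ofReal_re] at this
      rw [← this, hS, Finset.mul_sum, Complex.re_sum]
      simp [mul_pow]
    rw [h1, EuclideanSpace.real_norm_sq_eq]
    refine Finset.sum_le_sum fun n _ => ?_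
    simp only [hx, sq, Complex.mul_re (u * z n) (u * z n)]
    nlinarith [mul_self_nonneg (u * z n).im]
  refine hSx.trans (pow_le_pow_left₀ (norm_nonneg _) ?_ 2)
  -- For `x = 0` the convention `0⁻¹ = 0` gives the test vector `0`, which still serves.
  have ht : ‖‖x‖⁻¹ • x‖ ≤ 1 := by
    rw [norm_smul, norm_inv, norm_norm]
    exact inv_mul_le_one
  refine le_trans ?_ (norm_sum_le_supNorm z ht)
  have h2 : ‖∑ n, z n * ((‖x‖⁻¹ • x) n : ℂ)‖ = ‖u * ∑ n, z n * ((‖x‖⁻¹ • x) n : ℂ)‖ := by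
    rw [norm_mul, hu1, one_mul]
  have h3 : (u * ∑ n, z n * ((‖x‖⁻¹ • x) n : ℂ)).re = ‖x‖ := by
    have : ∑ n, (u * z n).re * (‖x‖⁻¹ * x n) = ‖x‖⁻¹ * ‖x‖ ^ 2 := by
      rw [EuclideanSpace.real_norm_sq_eq, Finset.mul_sum]
      refine Finset.sum_congr rfl fun n _ => ?_
      simp only [hx]
      ring
    rw [Finset.mul_sum, Complex.re_sum]
    simp only [← mul_assoc, Complex.re_mul_ofReal, PiLp.smul_apply, smul_eq_mul]
    simp only [← mul_assoc] at this
    rw [this, sq, ← mul_assoc]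
    exact inv_mul_mul_self _
  rw [h2]
  exact h3.symm.le.trans ((le_abs_self _).trans (Complex.abs_re_le_norm _))

/-! ### Exponential type as a growth bound -/

lemma log_enorm_le_iff {w : ℂ} {a : ℝ} : ENNReal.log ‖w‖ₑ ≤ (a : EReal) ↔ ‖w‖ ≤ Real.exp a := by
  rw [← EReal.log_exp (a : EReal), ENNReal.log_le_log_iff, EReal.exp_coe, ← ofReal_norm,
    ENNReal.ofReal_le_ofReal_iff (Real.exp_pos a).le]

lemma expType_le_iff {d : ℕ} {F : EuclideanSpace ℂ (Fin d) → ℂ} {δ : ℝ} :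
    expType F ≤ (δ : EReal) ↔ ∀ c : ℝ, δ < c →
      ∃ R : ℝ, ∀ z, R ≤ supNorm z → ‖F z‖ ≤ Real.exp (c * supNorm z) := by
  have hdiv {c : ℝ} {z : EuclideanSpace ℂ (Fin d)} (hz : 0 < supNorm z) :
      ENNReal.log ‖F z‖ₑ / (supNorm z : EReal) ≤ (c : EReal) ↔
        ‖F z‖ ≤ Real.exp (c * supNorm z) := by
    rw [EReal.div_le_iff_le_mul (by exact_mod_cast hz) (EReal.coe_ne_top _), ← EReal.coe_mul,
      log_enorm_le_iff, mul_comm]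
  constructor
  · intro h c hc
    have h1 := eventually_lt_of_limsup_lt (lt_of_le_of_lt h (EReal.coe_lt_coe_iff.2 hc))
    rw [eventually_comap] at h1
    obtain ⟨R, hR⟩ := eventually_atTop.1 h1
    refine ⟨max R 1, fun z hz => (hdiv ?_).1 (hR _ ((le_max_left _ _).trans hz) z rfl).le⟩
    exact one_pos.trans_le ((le_max_right _ _).trans hz)
  · intro h
    refine EReal.le_of_forall_lt_iff_le.1 fun c hc => ?_
    obtain ⟨R, hR⟩ := h c (EReal.coe_lt_coe_iff.1 hc)
    refine limsup_le_of_le (h := ?_)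
    rw [eventually_comap]
    filter_upwards [eventually_ge_atTop (max R 1)] with a ha z hz
    subst hz
    exact (hdiv (one_pos.trans_le ((le_max_right _ _).trans ha))).2
      (hR z ((le_max_left _ _).trans ha))

/-! ### Even entire functions -/

/-- An even entire function is an entire function of the square of its variable. -/
lemma exists_entire_comp_sq {g : ℂ → ℂ} (hg : Differentiable ℂ g) (heven : ∀ w, g (-w) = g w) :
    ∃ k : ℂ → ℂ, Differentiable ℂ k ∧ ∀ w, k (w ^ 2) = g w := by
  have hsq {a b : ℂ} (h : a ^ 2 = b ^ 2) : g a = g b := by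
    rcases sq_eq_sq_iff_eq_or_eq_neg.1 h with rfl | rfl
    · rfl
    · exact heven b
  have hroot (w : ℂ) : (w ^ (2⁻¹ : ℂ)) ^ 2 = w := by
    simp
  set k : ℂ → ℂ := fun w => g (w ^ (2⁻¹ : ℂ)) with hk
  have hslit (w : ℂ) (hw : w ∈ Complex.slitPlane) : DifferentiableAt ℂ k w :=
    (hg _).comp w (differentiableAt_id.cpow (differentiableAt_const _) hw)
  -- The principal root jumps on the negative axis; the root `I * (-w)^(1/2)` is holomorphic there,
  -- and evenness of `g` makes the choice of root immaterial. The origin is then a removable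
  -- singularity.
  have hkneg : k = fun w => g (Complex.I * (-w) ^ (2⁻¹ : ℂ)) := by
    funext w
    refine hsq ?_
    rw [mul_pow, hroot, hroot, Complex.I_sq]
    ring
  have hpunct (w : ℂ) (hw : w ≠ 0) : DifferentiableAt ℂ k w := by
    rcases Complex.mem_slitPlane_or_neg_mem_slitPlane hw with h | h
    · exact hslit w h
    · rw [hkneg]
      exact (hg _).comp w ((differentiableAt_id.neg.cpow (differentiableAt_const _) h).const_mul _)
  have hcont : ContinuousAt k 0 := by
    refine (hg _).continuousAt.comp ?_
    exact Complex.continuousAt_cpow_zero_of_re_pos (by norm_num) |>.comp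
      (f := fun w : ℂ => (w, (2⁻¹ : ℂ))) (by fun_prop)
  refine ⟨k, fun w => ?_, fun w => hsq (hroot _)⟩
  rcases eq_or_ne w 0 with rfl | hw
  · exact (Complex.analyticAt_of_differentiable_on_punctured_nhds_of_continuousAt
      (eventually_nhdsWithin_of_forall fun w hw => hpunct w hw) hcont).differentiableAt
  · exact hpunct w hw

/-! ### Surface measure and real points -/

instance (d : ℕ) : IsFiniteMeasure (surfaceMeasure d) := by
  unfold surfaceMeasure; infer_instance

instance (d : ℕ) : (surfaceMeasure d).IsOpenPosMeasure := by
  unfold surfaceMeasure; infer_instance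

lemma measurePreserving_neg_surfaceMeasure (d : ℕ) :
    MeasurePreserving (fun ω : Metric.sphere (0 : EuclideanSpace ℝ (Fin d)) 1 => -ω)
      (surfaceMeasure d) (surfaceMeasure d) := by
  have hm : Measurable (fun ω : Metric.sphere (0 : EuclideanSpace ℝ (Fin d)) 1 => -ω) :=
    continuous_neg.measurable
  refine ⟨hm, Measure.ext fun s hs => ?_⟩
  rw [Measure.map_apply hm hs, surfaceMeasure, Measure.toSphere_apply' _ hs,
    Measure.toSphere_apply' _ (hm hs)]
  congr 1
  rw [← Measure.measure_neg volume]
  congr 1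
  ext x
  simp only [Set.mem_neg, Set.mem_smul, Set.mem_image, Set.mem_preimage]
  constructor
  · rintro ⟨r, hr, _, ⟨ω, hω, rfl⟩, h⟩
    exact ⟨r, hr, _, ⟨-ω, hω, rfl⟩, by simp [h]⟩
  · rintro ⟨r, hr, _, ⟨ω, hω, rfl⟩, rfl⟩
    exact ⟨r, hr, _, ⟨-ω, by simpa using hω, rfl⟩, by simp⟩

@[fun_prop]
lemma continuous_toComplex {d : ℕ} : Continuous (toComplex (d := d)) := by
  unfold toComplex
  fun_prop

lemma toComplex_smul {d : ℕ} (r : ℝ) (x : EuclideanSpace ℝ (Fin d)) :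
    toComplex (r • x) = (r : ℂ) • toComplex x := by
  ext n
  simp [toComplex]

/-! ### Spherical means -/

section SphericalMean

variable {d : ℕ} {F : EuclideanSpace ℂ (Fin d) → ℂ}

/-- The integral of `F` over the unit sphere, scaled by a complex number. -/
noncomputable def sphericalMean (F : EuclideanSpace ℂ (Fin d) → ℂ) (w : ℂ) : ℂ :=
  ∫ ω, F (w • toComplex (ω : EuclideanSpace ℝ (Fin d))) ∂(surfaceMeasure d)

lemma integrable_sphere {E : Type*} [NormedAddCommGroup E]
    {f : Metric.sphere (0 : EuclideanSpace ℝ (Fin d)) 1 → E}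
    (hf : Continuous f) : Integrable f (surfaceMeasure d) :=
  hf.integrable_of_hasCompactSupport (HasCompactSupport.of_compactSpace f)

lemma sphericalMean_neg (w : ℂ) : sphericalMean F (-w) = sphericalMean F w := by
  have hm : MeasurableEmbedding
      (fun ω : Metric.sphere (0 : EuclideanSpace ℝ (Fin d)) 1 => -ω) :=
    (Homeomorph.neg _).measurableEmbedding
  rw [sphericalMean, sphericalMean, ← (measurePreserving_neg_surfaceMeasure d).integral_comp hm]
  refine integral_congr_ae (Eventually.of_forall fun ω => ?_)
  have := toComplex_smul (-1) (ω : EuclideanSpace ℝ (Fin d))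
  simp only [neg_smul, one_smul, Complex.ofReal_neg, Complex.ofReal_one] at this
  simp [this]

lemma differentiable_sphericalMean (hF : Differentiable ℂ F) :
    Differentiable ℂ (sphericalMean F) := by
  intro w₀
  have hcont : Continuous (Function.uncurry fun (ω : Metric.sphere (0 : EuclideanSpace ℝ (Fin d)) 1)
      (w : ℂ) => F (w • toComplex (ω : EuclideanSpace ℝ (Fin d)))) := by
    have := hF.continuous
    simp only [Function.uncurry_def]
    fun_prop
  have hdiff (ω : Metric.sphere (0 : EuclideanSpace ℝ (Fin d)) 1) :
      Differentiable ℂ fun w : ℂ => F (w • toComplex (ω : EuclideanSpace ℝ (Fin d))) :=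
    hF.comp (differentiable_id.smul_const _)
  -- Radius 2 contains every unit circle centred in the unit ball about `w₀`, so Cauchy's estimate
  -- bounds the derivatives uniformly in `ω`.
  obtain ⟨C, hC⟩ := ((isCompact_univ (X := Metric.sphere (0 : EuclideanSpace ℝ (Fin d)) 1)).prod
    (isCompact_closedBall w₀ 2)).exists_bound_of_continuousOn hcont.continuousOn
  refine (hasDerivAt_integral_of_dominated_loc_of_deriv_le (bound := fun _ => C / 1)
    (F := fun w (ω : Metric.sphere (0 : EuclideanSpace ℝ (Fin d)) 1) =>
      F (w • toComplex (ω : EuclideanSpace ℝ (Fin d))))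
    (F' := fun w ω => deriv (fun w : ℂ => F (w • toComplex (ω : EuclideanSpace ℝ (Fin d)))) w)
    (Metric.ball_mem_nhds w₀ one_pos) ?_ ?_ ?_ ?_ (integrable_const _) ?_).2.differentiableAt
  · exact Eventually.of_forall fun w =>
      (hcont.comp (Continuous.prodMk_left w)).aestronglyMeasurable
  · exact integrable_sphere (hcont.comp (Continuous.prodMk_left w₀))
  · exact ((measurable_deriv_with_param hcont).comp measurable_prodMk_right).aestronglyMeasurable
  · refine Eventually.of_forall fun ω w hw =>
      Complex.norm_deriv_le_of_forall_mem_sphere_norm_le one_pos (hdiff ω).diffContOnCl ?_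
    intro v hv
    refine hC (ω, v) ⟨trivial, ?_⟩
    rw [Metric.mem_ball] at hw
    rw [mem_sphere_iff_norm, ← dist_eq_norm] at hv
    rw [Metric.mem_closedBall]
    linarith [dist_triangle v w w₀]
  · exact Eventually.of_forall fun ω w _ => (hdiff ω w).hasDerivAt

lemma norm_sphericalMean_le {w : ℂ} {C : ℝ}
    (h : ∀ z : EuclideanSpace ℂ (Fin d), supNorm z = ‖w‖ → ‖F z‖ ≤ C) :
    ‖sphericalMean F w‖ ≤ C * (surfaceMeasure d).real Set.univ :=
  norm_integral_le_of_norm_le_const (Eventually.of_forall fun ω =>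
    h _ (supNorm_smul_toComplex w (norm_eq_of_mem_sphere ω)))

lemma re_sphericalMean (hF : Differentiable ℂ F) (r : ℝ) :
    (sphericalMean F r).re =
      ∫ ω, realRestrict F (r • (ω : EuclideanSpace ℝ (Fin d))) ∂(surfaceMeasure d) := by
  have := hF.continuous
  have hi : Integrable (fun ω : Metric.sphere (0 : EuclideanSpace ℝ (Fin d)) 1 =>
      F ((r : ℂ) • toComplex (ω : EuclideanSpace ℝ (Fin d)))) (surfaceMeasure d) :=
    integrable_sphere (by fun_prop)
  simp only [realRestrict, toComplex_smul]
  exact (integral_re hi).symm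

lemma im_sphericalMean (hF : Differentiable ℂ F)
    (hreal : ∀ x : EuclideanSpace ℝ (Fin d), (F (toComplex x)).im = 0) (r : ℝ) :
    (sphericalMean F r).im = 0 := by
  have := hF.continuous
  have hi : Integrable (fun ω : Metric.sphere (0 : EuclideanSpace ℝ (Fin d)) 1 =>
      F ((r : ℂ) • toComplex (ω : EuclideanSpace ℝ (Fin d)))) (surfaceMeasure d) :=
    integrable_sphere (by fun_prop)
  refine (integral_im hi).symm.trans ?_
  simp only [← toComplex_smul]
  exact (integral_congr_ae (Eventually.of_forall fun ω => hreal _)).trans (by simp)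

lemma continuous_realRestrict (hF : Differentiable ℂ F) : Continuous (realRestrict F) :=
  Complex.continuous_re.comp (hF.continuous.comp continuous_toComplex)

/-- An entire function on `ℂ^d` that vanishes at all real points of large norm is zero. -/
lemma eq_zero_of_eventually_zero_on_real (hd : 1 ≤ d) (hF : Differentiable ℂ F) {R : ℝ}
    (h : ∀ x : EuclideanSpace ℝ (Fin d), R ≤ ‖x‖ → F (toComplex x) = 0) : F = 0 := by
  -- On a complex line with real base point and real direction, `F` vanishes along a real ray, hence
  -- on the whole line. Each `z = x + iy` lies on such a line.
  have key (x y : EuclideanSpace ℝ (Fin d)) (hy : y ≠ 0) (w : ℂ) :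
      F (toComplex x + w • toComplex y) = 0 := by
    have hd1 : Differentiable ℂ fun w : ℂ => F (toComplex x + w • toComplex y) :=
      hF.comp ((differentiable_id.smul_const _).const_add _)
    set t₀ : ℝ := (R + ‖x‖) / ‖y‖ with ht₀
    have hy' : 0 < ‖y‖ := norm_pos_iff.2 hy
    have hz (t : ℝ) (ht : t₀ ≤ t) : F (toComplex x + (t : ℂ) • toComplex y) = 0 := by
      have hadd : toComplex x + (t : ℂ) • toComplex y = toComplex (x + t • y) := by
        ext n; simp [toComplex]
      rw [hadd]
      refine h _ ?_
      have h1 : R + ‖x‖ ≤ t * ‖y‖ := (div_le_iff₀ hy').1 ht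
      have h2 : t * ‖y‖ ≤ ‖t • y‖ := by
        rw [norm_smul]; exact mul_le_mul_of_nonneg_right (le_abs_self t) hy'.le
      have h3 := norm_sub_norm_le (t • y) (-x)
      rw [sub_neg_eq_add, norm_neg, add_comm (t • y)] at h3
      linarith
    have hfreq : ∃ᶠ w in nhdsWithin (t₀ : ℂ) {(t₀ : ℂ)}ᶜ,
        F (toComplex x + w • toComplex y) = 0 := by
      have htend : Tendsto (fun t : ℝ => (t : ℂ)) (nhdsWithin t₀ (Set.Ioi t₀))
          (nhdsWithin (t₀ : ℂ) {(t₀ : ℂ)}ᶜ) := by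
        refine tendsto_nhdsWithin_iff.2
          ⟨(Complex.continuous_ofReal.tendsto t₀).mono_left nhdsWithin_le_nhds, ?_⟩
        filter_upwards [self_mem_nhdsWithin] with t ht
        simpa using (ne_of_gt ht)
      refine htend.frequently (Eventually.frequently ?_)
      filter_upwards [self_mem_nhdsWithin] with t ht using hz t (le_of_lt ht)
    have := AnalyticOnNhd.eq_of_frequently_eq (g := fun _ => (0 : ℂ))
      (fun w _ => hd1.analyticAt w) (fun w _ => analyticAt_const) hfreq
    exact congrFun this w
  funext z
  set x : EuclideanSpace ℝ (Fin d) := WithLp.toLp 2 fun n => (z n).re with hx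
  set y : EuclideanSpace ℝ (Fin d) := WithLp.toLp 2 fun n => (z n).im with hy
  have hz : z = toComplex x + Complex.I • toComplex y := by
    ext n
    simp [toComplex, hx, hy, mul_comm Complex.I, Complex.re_add_im]
  by_cases hy0 : y = 0
  · have h0 := key x (EuclideanSpace.single ⟨0, hd⟩ 1) (by simp) 0
    rw [hz, hy0, show toComplex (0 : EuclideanSpace ℝ (Fin d)) = 0 by ext; simp [toComplex],
      smul_zero]
    rwa [zero_smul] at h0
  · rw [hz]
    exact key x y hy0 Complex.I

/-- On a large sphere `F` is continuous and non-negative, and the surface measure charges open sets,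
so zero mean means zero pointwise. -/
lemma sphericalMean_ne_zero (hd : 1 ≤ d) (hF : Differentiable ℂ F) (hF0 : F ≠ 0)
    (hreal : ∀ x : EuclideanSpace ℝ (Fin d), (F (toComplex x)).im = 0)
    (hnn : EventuallyNonneg (realRestrict F)) : sphericalMean F ≠ 0 := by
  intro h0
  obtain ⟨R, hR⟩ := hnn
  refine hF0 (eq_zero_of_eventually_zero_on_real hd hF (R := max R 1) fun x hx => ?_)
  have hxpos : 0 < ‖x‖ := one_pos.trans_le ((le_max_right _ _).trans hx)
  have hcont : Continuous fun ω : Metric.sphere (0 : EuclideanSpace ℝ (Fin d)) 1 =>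
      realRestrict F (‖x‖ • (ω : EuclideanSpace ℝ (Fin d))) :=
    (continuous_realRestrict hF).comp (by fun_prop)
  have hint := re_sphericalMean hF ‖x‖
  rw [h0, Pi.zero_apply, Complex.zero_re, eq_comm, integral_eq_zero_iff_of_nonneg
    (fun ω => hR _ (by
      rw [norm_smul, norm_norm, norm_eq_of_mem_sphere ω, mul_one]
      exact (le_max_left _ _).trans hx)) (integrable_sphere hcont),
    Continuous.ae_eq_iff_eq _ hcont continuous_zero] at hint
  have hω : ‖x‖⁻¹ • x ∈ Metric.sphere (0 : EuclideanSpace ℝ (Fin d)) 1 := by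
    rw [mem_sphere_zero_iff_norm, norm_smul, norm_inv, norm_norm, inv_mul_cancel₀ hxpos.ne']
  have := congrFun hint ⟨_, hω⟩
  simp only [smul_inv_smul₀ hxpos.ne', Pi.zero_apply] at this
  exact Complex.ext this (hreal x)

end SphericalMean

/-! ### Integration against the radial lift -/

section RadialLift

variable {μ : Measure ℝ} [IsLocallyFiniteMeasure μ] {d : ℕ}
  {h : EuclideanSpace ℝ (Fin d) → ℝ}

lemma measurable_polar : Measurable
    (fun p : ℝ × Metric.sphere (0 : EuclideanSpace ℝ (Fin d)) 1 =>
      p.1 • (p.2 : EuclideanSpace ℝ (Fin d))) :=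
  Continuous.measurable (by fun_prop)

lemma atom_ne_top : surfaceMeasure d Set.univ / 2 * μ {0} ≠ ∞ := by
  refine ENNReal.mul_ne_top (ENNReal.div_ne_top (measure_ne_top _ _) two_ne_zero) ?_
  exact isCompact_singleton.measure_lt_top.ne

lemma integrable_atom : Integrable h ((surfaceMeasure d Set.univ / 2 * μ {0}) • Measure.dirac 0) :=
  (integrable_dirac (by simp)).smul_measure atom_ne_top

lemma integrable_radialLift_iff (hh : Continuous h) :
    Integrable h (radialLift μ d) ↔
      Integrable (fun p : ℝ × Metric.sphere (0 : EuclideanSpace ℝ (Fin d)) 1 =>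
        h (p.1 • (p.2 : EuclideanSpace ℝ (Fin d))))
        ((μ.restrict (Set.Ioi 0)).prod (surfaceMeasure d)) := by
  rw [radialLift, integrable_add_measure, and_iff_left integrable_atom,
    integrable_map_measure hh.aestronglyMeasurable measurable_polar.aemeasurable]
  rfl

lemma integral_radialLift (hh : Continuous h) (hi : Integrable h (radialLift μ d)) :
    ∫ x, h x ∂(radialLift μ d) =
      ∫ r in Set.Ioi 0, (∫ ω, h (r • (ω : EuclideanSpace ℝ (Fin d))) ∂(surfaceMeasure d)) ∂μ
        + (surfaceMeasure d).real Set.univ / 2 * μ.real {0} * h 0 := by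
  have hp := (integrable_radialLift_iff hh).1 hi
  have hm := (integrable_map_measure hh.aestronglyMeasurable measurable_polar.aemeasurable).2 hp
  rw [radialLift, integral_add_measure hm integrable_atom,
    integral_map measurable_polar.aemeasurable hh.aestronglyMeasurable, integral_prod _ hp,
    integral_smul_measure, integral_dirac]
  simp [Measure.real, ENNReal.toReal_mul, ENNReal.toReal_div]

end RadialLift

/-! ### Transfer between dimensions -/

lemma expType_comp_sum_sq_le {d d' : ℕ} {F : EuclideanSpace ℂ (Fin d) → ℂ} {δ : ℝ} (hδ : 0 ≤ δ)
    (hF : expType F ≤ (δ : EReal)) {k : ℂ → ℂ} (hk : Differentiable ℂ k)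
    (hkF : ∀ w, k (w ^ 2) = sphericalMean F w) :
    expType (fun z : EuclideanSpace ℂ (Fin d') => k (∑ n, z n ^ 2)) ≤ (δ : EReal) := by
  rw [expType_le_iff] at hF ⊢
  intro c hc
  obtain ⟨c', hc', hcc'⟩ := exists_between hc
  obtain ⟨R, hR⟩ := hF c' hc'
  set σ := (surfaceMeasure d).real Set.univ with hσ
  obtain ⟨C, hC⟩ := (isCompact_closedBall (0 : ℂ) (R ^ 2)).exists_bound_of_continuousOn
    hk.continuous.continuousOn
  -- The gap between `c'` and `c` absorbs both constants: the total surface mass and the bound for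
  -- `k` on a compact disc.
  have htend : Tendsto (fun s : ℝ => Real.exp ((c - c') * s)) atTop atTop :=
    Real.tendsto_exp_atTop.comp (tendsto_id.const_mul_atTop (sub_pos.2 hcc'))
  obtain ⟨R', hR'⟩ := eventually_atTop.1 (htend.eventually_ge_atTop (max C σ))
  refine ⟨max R' 0, fun z hz => ?_⟩
  have hexp := hR' _ ((le_max_left _ _).trans hz)
  have hs0 : 0 ≤ supNorm z := supNorm_nonneg z
  have hsplit : Real.exp (c * supNorm z) =
      Real.exp (c' * supNorm z) * Real.exp ((c - c') * supNorm z) := by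
    rw [← Real.exp_add]; ring_nf
  have hc'0 : 0 ≤ c' := hδ.trans hc'.le
  obtain ⟨w, hw⟩ : ∃ w : ℂ, w ^ 2 = ∑ n, z n ^ 2 :=
    IsAlgClosed.exists_pow_nat_eq _ two_pos
  have hwz : ‖w‖ ≤ supNorm z := by
    refine (sq_le_sq₀ (norm_nonneg _) hs0).1 ?_
    rw [← norm_pow, hw]
    exact norm_sum_sq_le_supNorm_sq z
  rw [hsplit]
  -- `∑ zₙ²` can be small for large `z`, where the growth bound on `F` says nothing; compactness
  -- covers that case.
  rcases le_total R ‖w‖ with hRw | hRw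
  · rw [← hw, hkF]
    refine (norm_sphericalMean_le (C := Real.exp (c' * ‖w‖)) fun v hv => ?_).trans ?_
    · rw [← hv]
      exact hR v (hv.symm ▸ hRw)
    · have := (le_max_right C σ).trans hexp
      gcongr
  · have hball : (∑ n, z n ^ 2) ∈ Metric.closedBall (0 : ℂ) (R ^ 2) := by
      rw [mem_closedBall_zero_iff, ← hw, norm_pow]
      gcongr
    refine (hC _ hball).trans (((le_max_left C σ).trans hexp).trans ?_)
    exact le_mul_of_one_le_left (Real.exp_pos _).le
      (Real.one_le_exp (mul_nonneg hc'0 hs0))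

lemma Admissible.exists_radial {μ : Measure ℝ} [IsLocallyFiniteMeasure μ] {δ : ℝ} (hδ : 0 ≤ δ)
    {d d' : ℕ} (hd : 1 ≤ d) (hd' : 1 ≤ d') {F : EuclideanSpace ℂ (Fin d) → ℂ}
    (hF : Admissible μ δ d F) :
    ∃ G : EuclideanSpace ℂ (Fin d') → ℂ, Admissible μ δ d' G ∧
      ∀ r : ℝ, 0 < r → (∀ x, r ≤ ‖x‖ → 0 ≤ realRestrict F x) →
        ∀ x, r ≤ ‖x‖ → 0 ≤ realRestrict G x := by
  obtain ⟨k, hk, hkF⟩ := exists_entire_comp_sq (differentiable_sphericalMean hF.entire)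
    fun w => sphericalMean_neg w
  set G : EuclideanSpace ℂ (Fin d') → ℂ := fun z => k (∑ n, z n ^ 2) with hG
  have hGx (x : EuclideanSpace ℝ (Fin d')) : G (toComplex x) = sphericalMean F (‖x‖ : ℂ) := by
    rw [← hkF, ← Complex.ofReal_pow, EuclideanSpace.real_norm_sq_eq]
    simp [hG, toComplex]
  have hGre (x : EuclideanSpace ℝ (Fin d')) : realRestrict G x =
      ∫ ω, realRestrict F (‖x‖ • (ω : EuclideanSpace ℝ (Fin d))) ∂(surfaceMeasure d) := by
    rw [realRestrict, hGx, re_sphericalMean hF.entire]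
  have hGd : Differentiable ℂ G := hk.comp (by fun_prop)
  have hnn (r : ℝ) (h : ∀ x, r ≤ ‖x‖ → 0 ≤ realRestrict F x) (x : EuclideanSpace ℝ (Fin d'))
      (hx : r ≤ ‖x‖) : 0 ≤ realRestrict G x := by
    rw [hGre]
    refine integral_nonneg fun ω => h _ ?_
    rwa [norm_smul, norm_norm, norm_eq_of_mem_sphere ω, mul_one]
  have hFc := continuous_realRestrict hF.entire
  have hGc := continuous_realRestrict hGd
  set φ : ℝ → ℝ := fun r =>
    ∫ ω, realRestrict F (r • (ω : EuclideanSpace ℝ (Fin d))) ∂(surfaceMeasure d) with hφ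
  have hφi : Integrable φ (μ.restrict (Set.Ioi 0)) :=
    ((integrable_radialLift_iff hFc).1 hF.integrable).integral_prod_left
  have hGφ {r : ℝ} (hr : 0 < r) (ω : Metric.sphere (0 : EuclideanSpace ℝ (Fin d')) 1) :
      realRestrict G (r • (ω : EuclideanSpace ℝ (Fin d'))) = φ r := by
    rw [hGre, norm_smul, norm_eq_of_mem_sphere ω, mul_one, Real.norm_of_nonneg hr.le]
  have hGi : Integrable (realRestrict G) (radialLift μ d') := by
    rw [integrable_radialLift_iff hGc]
    refine (hφi.comp_fst (surfaceMeasure d')).congr ?_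
    have h1 : ∀ᵐ p ∂((μ.restrict (Set.Ioi 0)).prod (surfaceMeasure d')), 0 < p.1 :=
      Measure.quasiMeasurePreserving_fst.ae (ae_restrict_mem measurableSet_Ioi)
    filter_upwards [h1] with p hp
    exact (hGφ hp p.2).symm
  refine ⟨G, ⟨?_, hGd, fun x => ?_, expType_comp_sum_sq_le hδ hF.expType_le hk hkF, hGi, ?_, ?_⟩,
    fun r _ h => hnn r h⟩
  · intro h0
    refine sphericalMean_ne_zero hd hF.entire hF.ne_zero hF.real hF.eventuallyNonneg ?_
    funext w
    -- On a coordinate axis `∑ zₙ²` is `w²`, so `G` restricts to the spherical mean itself.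
    have := congrFun h0 (EuclideanSpace.single ⟨0, hd'⟩ w)
    rw [Pi.zero_apply] at this ⊢
    rw [← this, ← hkF, hG]
    simp [ite_pow]
  · rw [hGx, im_sphericalMean hF.entire hF.real]
  · have hFint := integral_radialLift hFc hF.integrable
    have h1 : ∫ r in Set.Ioi 0, (∫ ω, realRestrict G (r • (ω : EuclideanSpace ℝ (Fin d')))
        ∂(surfaceMeasure d')) ∂μ = (surfaceMeasure d').real Set.univ * ∫ r in Set.Ioi 0, φ r ∂μ := by
      rw [← integral_const_mul]
      refine setIntegral_congr_fun measurableSet_Ioi fun r hr => ?_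
      simp only [hGφ hr, integral_const, smul_eq_mul]
    have h2 : realRestrict G 0 = (surfaceMeasure d).real Set.univ * realRestrict F 0 := by
      rw [hGre]
      simp
    rw [integral_radialLift hGc hGi, h1, h2]
    -- The atom scales like the rest: its weight carries the mass of the sphere in `ℝ^d'`, and
    -- `G(0)` that of the sphere in `ℝ^d`.
    have h3 : (surfaceMeasure d').real Set.univ * (∫ r in Set.Ioi 0, φ r ∂μ) +
        (surfaceMeasure d').real Set.univ / 2 * μ.real {0} *
          ((surfaceMeasure d).real Set.univ * realRestrict F 0) =
        (surfaceMeasure d').real Set.univ * ∫ x, realRestrict F x ∂(radialLift μ d) := by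
      rw [hFint]; ring
    rw [h3]
    exact mul_nonpos_of_nonneg_of_nonpos measureReal_nonneg hF.integral_nonpos
  · obtain ⟨r, hr⟩ := hF.eventuallyNonneg
    exact ⟨r, hnn r hr⟩

lemma signConstant_le {μ : Measure ℝ} [IsLocallyFiniteMeasure μ] {δ : ℝ} (hδ : 0 ≤ δ)
    {d d' : ℕ} (hd : 1 ≤ d) (hd' : 1 ≤ d') : signConstant μ δ d' ≤ signConstant μ δ d := by
  refine le_sInf ?_
  rintro _ ⟨F, hF, rfl⟩
  obtain ⟨G, hG, hFG⟩ := Admissible.exists_radial hδ hd hd' hF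
  have hle : signConstant μ δ d' ≤ lastSignChange (realRestrict G) := sInf_le ⟨G, hG, rfl⟩
  refine hle.trans (sInf_le_sInf (Set.image_mono ?_))
  exact fun r hr => ⟨hr.1, hFG r hr.1 hr.2⟩

end SignUncertainty

theorem theorem1 (μ : MeasureTheory.Measure ℝ) [MeasureTheory.IsLocallyFiniteMeasure μ]
    [μ.IsNegInvariant] (δ : ℝ) (hδ : 0 ≤ δ) (d : ℕ) (hd : 1 ≤ d) :
    SignUncertainty.signConstant μ δ d = SignUncertainty.signConstant μ δ 1 :=
  le_antisymm (SignUncertainty.signConstant_le hδ le_rfl hd)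
    (SignUncertainty.signConstant_le hδ hd le_rfl)
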